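/- Let $n\ge 1$ and let $T:\mathbb{R}^n\to\mathbb{R}^n$ be Lipschitz, with Jacobian matrix $DT(x)$ (which exists for almost every $x$) Metzler for almost every $x$, i.e. $(DT(x))_{ij}\ge 0$ for all $i\ne j$. Put $$L=\mathrm{diagL}(-T):=\operatorname*{ess\,sup}_{x\in\mathbb{R}^n}\ \max_{1\le i\le n}\bigl(-DT(x)\bigr)_{ii},$$ and consider, for a step size $\theta>0$ and an initial state $x(0)\in\mathbb{R}^n$, the Krasnoselskij iteration $$x(k+1)=(1-\theta)\,x(k)+\theta\,T(x(k)),\qquad k=0,1,2,\dots$$ For $\eta\in\mathbb{R}^n$ with positive entries and $c\ge 0$, call $T$ $c$-strictly $\eta$-subhomogeneous if $T(x+t\eta)\le T(x)+t(1-c)\eta$ componentwise for all $x\in\mathbb{R}^n$ and $t>0$, and $\eta$-subhomogeneous if this holds with $c=0$; let $\mathrm{fix}(T)=\{x: T(x)=x\}$ and $\|x\|_{\infty,[\eta]^{-1}}=\max_i |x_i|/\eta_i$. Then the following hold. (a) If $T$ is $\eta$-subhomogeneous for some positive vector $\eta$ and $\mathrm{fix}(T)\neq\emptyset$, then $1+L\ge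 0$, and for every $\theta\in\bigl(0,\tfrac1{1+L}\bigr)$ (where $\tfrac1{1+L}$ is read as $+\infty$ if $L=-1$) and every $x(0)$ the iteration converges to some $\bar x\in\mathrm{fix}(T)$. (b) If $T$ is strictly subhomogeneous, i.e. $c$-strictly $\eta$-subhomogeneous for some positive vector $\eta$ and some $c>0$, then $1+L>0$, $T$ has a unique fixed point $x^\star$, and for every $\theta\in\bigl(0,\tfrac1{1+L}\bigr]$ and every $x(0)$ the iteration converges to $x^\star$, with $$\|x(k+1)-x^\star\|_{\infty,[\eta]^{-1}}\le(1-\theta c)\,\|x(k)-x^\star\|_{\infty,[\eta]^{-1}}\qquad\text{for all }k\ge 0.$$ The convergence rate is optimized on $\bigl(0,\tfrac1{1+L}\bigr]$ at $\theta=\tfrac1{1+L}$, and only there: both the guaranteed factor $1-\theta c$ and the actual rate $\rho(\theta)$, defined as the smallest $\rho\ge 0$ such that $\|x(k+1)-x^\star\|_{\infty,[\eta]^{-1}}\le\rho\,\|x(k)-x^\star\|_{\infty,[\eta]^{-1}}$ for all $x(0)$ and all $k\ge0$, are strictly smaller at $\theta=\tfrac1{1+L}$ than at any $\theta\in\bigl(0,\tfrac1{1+L}\bigr)$.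 -/

import Mathlib

open Set Filter Topology MeasureTheory

noncomputable section

/-- The Jacobian matrix `DT(x)` of `T : ℝⁿ → ℝⁿ`, entry `(i, j)` being `∂Tᵢ/∂xⱼ`.
It is meaningful at the points of differentiability of `T`, that is, for a Lipschitz `T`, at
almost every point. -/
def jacobian {n : ℕ} (T : (Fin n → ℝ) → (Fin n → ℝ)) (x : Fin n → ℝ) :
    Matrix (Fin n) (Fin n) ℝ :=
  LinearMap.toMatrix' (fderiv ℝ T x : (Fin n → ℝ) →ₗ[ℝ] (Fin n → ℝ))

/-- A matrix is Metzler if its off-diagonal entries are nonnegative. -/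
def IsMetzler {n : ℕ} (A : Matrix (Fin n) (Fin n) ℝ) : Prop :=
  ∀ i j, i ≠ j → 0 ≤ A i j

/-- `diagL F = ess sup_x max_i (DF(x))_{ii}`, with respect to Lebesgue measure. -/
def diagL {n : ℕ} (F : (Fin n → ℝ) → (Fin n → ℝ)) : ℝ :=
  essSup (fun x => ⨆ i, jacobian F x i i) (volume : Measure (Fin n → ℝ))

/-- `T` is `c`-strictly `η`-subhomogeneous:
`T (x + t η) ≤ T x + t (1 - c) η` (componentwise) for all `x` and all `t > 0`.
For `c = 0` this is `η`-subhomogeneity. -/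
def IsStrictlySubhomogeneous {n : ℕ} (c : ℝ) (η : Fin n → ℝ)
    (T : (Fin n → ℝ) → (Fin n → ℝ)) : Prop :=
  ∀ x : Fin n → ℝ, ∀ t : ℝ, 0 < t → T (x + t • η) ≤ T x + (t * (1 - c)) • η

/-- `T` is `η`-subhomogeneous. -/
def IsSubhomogeneous {n : ℕ} (η : Fin n → ℝ) (T : (Fin n → ℝ) → (Fin n → ℝ)) : Prop :=
  IsStrictlySubhomogeneous 0 η T

/-- The diagonally weighted sup norm `‖[η]⁻¹ x‖_∞ = max_i |x_i| / η_i`. -/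
def weightedSupNorm {n : ℕ} (η x : Fin n → ℝ) : ℝ :=
  ‖fun i => (η i)⁻¹ * x i‖

/-- The Krasnoselskij operator `T_θ = (1 - θ) Id + θ T`. -/
def krasnoselskij {n : ℕ} (T : (Fin n → ℝ) → (Fin n → ℝ)) (θ : ℝ) (x : Fin n → ℝ) :
    Fin n → ℝ :=
  (1 - θ) • x + θ • T x

/-- The state at time `k` of the Krasnoselskij iteration `x(k+1) = (1 - θ) x(k) + θ T(x(k))`
started at `x₀`. -/
def trajectory {n : ℕ} (T : (Fin n → ℝ) → (Fin n → ℝ)) (θ : ℝ) (x₀ : Fin n → ℝ) (k : ℕ) :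
    Fin n → ℝ :=
  (krasnoselskij T θ)^[k] x₀

/-- The convergence rate of the Krasnoselskij iteration with step size `θ` towards `p`: the
smallest `ρ ≥ 0` such that, along every trajectory and at every step, the distance to `p` in the
norm `‖[η]⁻¹ ·‖_∞` is multiplied by at most `ρ`. -/
def convergenceRate {n : ℕ} (η : Fin n → ℝ) (T : (Fin n → ℝ) → (Fin n → ℝ))
    (p : Fin n → ℝ) (θ : ℝ) : ℝ :=
  sInf {ρ : ℝ | 0 ≤ ρ ∧ ∀ (x₀ : Fin n → ℝ) (k : ℕ),
    weightedSupNorm η (trajectory T θ x₀ (k + 1) - p)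
      ≤ ρ * weightedSupNorm η (trajectory T θ x₀ k - p)}

end

/-!
With `L = diagL (-T)`, the Jacobian of `T + L • id` is almost everywhere entrywise nonnegative, so
`T + L • id` is monotone for the componentwise order (`monotone_add_diagL_smul`, via Fubini and
the fundamental theorem of calculus on lines). Hence
`T_θ = (1 - θ (1 + L)) • id + θ • (T + L • id)` is monotone as soon as `θ (1 + L) ≤ 1`. It is also
`θ c`-strictly `η`-subhomogeneous, and a monotone map with this property is Lipschitz with constant
`1 - θ c` for the norm `‖[η]⁻¹ ·‖_∞` (`IsStrictlySubhomogeneous.weightedSupNorm_sub_le`). Comparing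
monotonicity and subhomogeneity along `η` gives `c ≤ 1 + L`.

If `c > 0`, Banach's fixed point theorem applies for all `θ ≤ 1 / (1 + L)`. If `c = 0`, then `T_θ`
with `θ < 1 / (1 + L)` is a proper average of the identity and a nonexpansive `T_s`, `s > θ`, and
its orbits converge by a sup norm form of Krasnoselskij's theorem
(`exists_fixedPoint_tendsto_iterate_averaged`).

For the optimality of `s = 1 / (1 + L)`, the contraction factor towards the fixed point `p` of the
monotone map `T_s` is decided on the points `p + r • η`. There `T_s x - p` and `x - p` have the same
sign, so the factor of the average `T_θ`, with `θ = a s`, is at least `(1 - a) + a ρ(s)`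
(`averaged_le_convergenceRate`). This exceeds `ρ(s)` because `ρ(s) ≤ 1 - s c < 1` and `a < 1`.
-/

/-! ### Monotonicity from an almost everywhere sign of the derivative -/

/-- A Lipschitz function whose derivative in the direction `v` is almost everywhere nonnegative is
nondecreasing along `v`. By Fubini, almost every line parallel to `v` meets the exceptional set in a
null set; on such a line the fundamental theorem of calculus for absolutely continuous functions
applies, and the remaining base points are reached by continuity. -/
theorem LipschitzWith.le_add_of_ae_lineDeriv_nonneg {E : Type*} [NormedAddCommGroup E]
    [NormedSpace ℝ E] [FiniteDimensional ℝ E] [MeasurableSpace E] [BorelSpace E]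
    (μ : Measure E) [μ.IsAddHaarMeasure] {f : E → ℝ} {C : NNReal} (hf : LipschitzWith C f)
    (v : E) (h : ∀ᵐ x ∂μ, 0 ≤ lineDeriv ℝ f x v) (x : E) : f x ≤ f (x + v) := by
  let A : ℝ →L[ℝ] E := ContinuousLinearMap.smulRight (1 : ℝ →L[ℝ] ℝ) v
  have hmeas : MeasurableSet {x | 0 ≤ lineDeriv ℝ f x v} :=
    measurableSet_le measurable_const (measurable_lineDeriv hf.continuous)
  have hlines : ∀ᵐ x ∂μ, ∀ᵐ t : ℝ, 0 ≤ lineDeriv ℝ f (x + t • v) v :=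
    (ae_ae_add_linearMap_mem_iff A.toLinearMap volume μ hmeas).2 h
  have hae : ∀ᵐ x ∂μ, f x ≤ f (x + v) := by
    filter_upwards [hlines] with x hx
    have hlip := hf.comp ((LipschitzWith.const x).add A.lipschitz)
    have hFTC := ((hlip.lipschitzOnWith (s := uIcc 0 1)).absolutelyContinuousOnInterval
      ).integral_deriv_eq_sub
    have hnonneg : 0 ≤ ∫ t in (0 : ℝ)..1, deriv (f ∘ fun t => x + A t) t := by
      refine intervalIntegral.integral_nonneg_of_ae zero_le_one ?_
      filter_upwards [hx] with t ht
      have hshift : (fun s : ℝ => f (x + t • v + s • v)) =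
          fun s => (f ∘ fun t => x + A t) (t + s) := by
        ext s
        simp [A, add_smul, add_assoc]
      rw [lineDeriv, hshift, deriv_comp_const_add, add_zero] at ht
      exact ht
    rw [hFTC] at hnonneg
    simpa [A] using hnonneg
  have hdense := Measure.dense_of_ae hae
  have hclosed : IsClosed {x | f x ≤ f (x + v)} :=
    isClosed_le hf.continuous (hf.continuous.comp (continuous_id.add continuous_const))
  exact hclosed.closure_subset (hdense x)

/-- The essential supremum `diagL` is a genuine almost everywhere bound, since the Jacobian of a
Lipschitz map is bounded. -/
theorem ae_neg_le_jacobian_diag {n : ℕ} {T : (Fin n → ℝ) → (Fin n → ℝ)} {K : NNReal}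
    (hT : LipschitzWith K T) :
    ∀ᵐ x ∂(volume : Measure (Fin n → ℝ)), ∀ i, -diagL (fun x => -T x) ≤ jacobian T x i i := by
  have hneg (x : Fin n → ℝ) (i : Fin n) :
      jacobian (fun x => -T x) x i i = -jacobian T x i i := by
    simp [jacobian, LinearMap.toMatrix'_apply, fderiv_fun_neg]
  have hbound (x : Fin n → ℝ) (i : Fin n) : jacobian (fun x => -T x) x i i ≤ K := by
    have h1 : ‖fderiv ℝ T x (Pi.single i 1)‖ ≤ K := by
      simpa [Pi.norm_single] using (fderiv ℝ T x).le_of_opNorm_le (norm_fderiv_le_of_lipschitz ℝ hT)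
        (Pi.single i 1)
    have h2 := (norm_le_pi_norm (fderiv ℝ T x (Pi.single i 1)) i).trans h1
    rw [hneg]
    simpa [jacobian, LinearMap.toMatrix'_apply] using (neg_le_abs _).trans h2
  have hbdd : IsBoundedUnder (· ≤ ·) (ae (volume : Measure (Fin n → ℝ)))
      (fun x => ⨆ i, jacobian (fun x => -T x) x i i) :=
    ⟨K, eventually_map.2 (.of_forall fun x => Real.iSup_le (hbound x) K.coe_nonneg)⟩
  filter_upwards [ae_le_essSup hbdd] with x hx i
  have h := (le_ciSup (finite_range fun i => jacobian (fun x => -T x) x i i).bddAbove i).trans hx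
  rw [hneg] at h
  exact neg_le.1 h

/-- The Metzler condition makes the off-diagonal entries of the Jacobian of `T + L • id`
nonnegative, and the choice `L = diagL (-T)` the diagonal ones. -/
theorem monotone_add_diagL_smul {n : ℕ} {T : (Fin n → ℝ) → (Fin n → ℝ)} {K : NNReal}
    (hT : LipschitzWith K T)
    (hMetzler : ∀ᵐ x ∂(volume : Measure (Fin n → ℝ)), IsMetzler (jacobian T x)) :
    Monotone fun x => T x + diagL (fun x => -T x) • x := by
  set L := diagL (fun x => -T x)
  intro x y hxy i
  obtain ⟨v, rfl⟩ : ∃ v, y = x + v := ⟨y - x, by abel⟩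
  have hv : 0 ≤ v := by simpa using hxy
  let π : (Fin n → ℝ) →L[ℝ] ℝ := ContinuousLinearMap.proj i
  have hlip : LipschitzWith _ fun x => π (T x + L • x) :=
    π.lipschitz.comp (hT.add (lipschitzWith_smul L))
  refine hlip.le_add_of_ae_lineDeriv_nonneg volume v ?_ x
  filter_upwards [hT.ae_differentiableAt, hMetzler, ae_neg_le_jacobian_diag hT] with x hx hM hD
  have hderiv : HasFDerivAt (fun x => π (T x + L • x))
      (π.comp (fderiv ℝ T x + L • ContinuousLinearMap.id ℝ (Fin n → ℝ))) x :=
    π.hasFDerivAt.comp x (hx.hasFDerivAt.add ((hasFDerivAt_id x).const_smul L))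
  rw [(hderiv.hasLineDerivAt v).lineDeriv]
  have hJ : fderiv ℝ T x v i = ∑ j, jacobian T x i j * v j := by
    have := congrFun (LinearMap.toMatrix'_mulVec
      (fderiv ℝ T x : (Fin n → ℝ) →ₗ[ℝ] (Fin n → ℝ)) v) i
    simpa [jacobian, Matrix.mulVec, dotProduct] using this.symm
  have hoff : 0 ≤ ∑ j ∈ Finset.univ.erase i, jacobian T x i j * v j :=
    Finset.sum_nonneg fun j hj => mul_nonneg (hM i j (Finset.ne_of_mem_erase hj).symm) (hv j)
  have hdiag : 0 ≤ (jacobian T x i i + L) * v i := mul_nonneg (by linarith [hD i]) (hv i)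
  have hsum := Finset.add_sum_erase Finset.univ (fun j => jacobian T x i j * v j)
    (Finset.mem_univ i)
  simp only [π, ContinuousLinearMap.comp_apply, _root_.add_apply,
    ContinuousLinearMap.proj_apply, Pi.add_apply, hJ, _root_.smul_apply,
    ContinuousLinearMap.id_apply, Pi.smul_apply, smul_eq_mul]
  linarith

/-! ### Averaged nonexpansive maps in the sup norm -/

/-- Krasnoselskij's theorem for the sup norm: if `N` is nonexpansive and has a fixed point, every
orbit of the averaged map `(1 - a) • id + a • N` converges to a fixed point of `N`.

The orbit is bounded, so it has a cluster point `y`, and the displacement `dist (S^[k+1]) (S^[k])`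
is constant, `= δ`, along the orbit of `y`. At each time some coordinate moves by exactly `± δ`; as
a proper average of two quantities of absolute value at most `δ`, it moved by the same signed amount
at all earlier times. So after `m` steps the orbit of `y` has moved by `m * δ`, and boundedness
forces `δ = 0`. -/
theorem exists_fixedPoint_tendsto_iterate_averaged {ι : Type*} [Fintype ι]
    {N S : (ι → ℝ) → (ι → ℝ)} (hN : LipschitzWith 1 N) {a : ℝ} (ha₀ : 0 < a) (ha₁ : a < 1)
    (hS : ∀ x, S x = (1 - a) • x + a • N x) {p : ι → ℝ} (hp : N p = p) (x : ι → ℝ) :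
    ∃ q, N q = q ∧ Tendsto (fun k => S^[k] x) atTop (𝓝 q) := by
  have hNdist (x y) : dist (N x) (N y) ≤ dist x y := by simpa using hN.dist_le_mul x y
  have hSdist (x y) : dist (S x) (S y) ≤ dist x y := by
    rw [hS, hS]
    calc dist ((1 - a) • x + a • N x) ((1 - a) • y + a • N y)
        ≤ dist ((1 - a) • x) ((1 - a) • y) + dist (a • N x) (a • N y) := dist_add_add_le _ _ _ _
      _ = (1 - a) * dist x y + a * dist (N x) (N y) := by
        rw [dist_smul₀, dist_smul₀, Real.norm_of_nonneg (by linarith), Real.norm_of_nonneg ha₀.le]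
      _ ≤ dist x y := by nlinarith [hNdist x y]
  have hScont : Continuous S :=
    (LipschitzWith.of_dist_le_mul (K := 1) (by simpa using hSdist)).continuous
  have hfix {q : ι → ℝ} : S q = q ↔ N q = q := by
    have h : S q - q = a • (N q - q) := by rw [hS]; module
    rw [← sub_eq_zero, h, smul_eq_zero, or_iff_right ha₀.ne', sub_eq_zero]
  have hanti {q : ι → ℝ} (hq : S q = q) (x : ι → ℝ) : Antitone fun k => dist (S^[k] x) q := by
    refine antitone_nat_of_succ_le fun k => ?_
    rw [Function.iterate_succ_apply']
    simpa [hq] using hSdist (S^[k] x) q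
  have hbdd (x : ι → ℝ) (k : ℕ) : dist (S^[k] x) p ≤ dist x p := by
    simpa using hanti (hfix.2 hp) x (Nat.zero_le k)
  obtain ⟨y, -, φ, hφ, hy⟩ := tendsto_subseq_of_bounded
    (Metric.isBounded_closedBall (x := p) (r := dist x p)) (fun k => hbdd x k)
  obtain ⟨δ, hδ⟩ : ∃ δ, Tendsto (fun k => dist (S^[k + 1] x) (S^[k] x)) atTop (𝓝 δ) := by
    refine ⟨_, tendsto_atTop_ciInf (antitone_nat_of_succ_le fun k => ?_)
      ⟨0, forall_mem_range.2 fun k => dist_nonneg⟩⟩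
    rw [Function.iterate_succ_apply' S (k + 1), Function.iterate_succ_apply' S k]
    exact hSdist _ _
  -- The displacement is a limit along the orbit of `x`, so it is constant along that of `y`.
  have hstep (m : ℕ) : dist (S^[m + 1] y) (S^[m] y) = δ := by
    have hlim := (((hScont.iterate (m + 1)).tendsto y).comp hy).dist
      (((hScont.iterate m).tendsto y).comp hy)
    refine tendsto_nhds_unique hlim ?_
    have hsub : Tendsto (fun k => m + φ k) atTop atTop :=
      tendsto_atTop_mono (fun k => Nat.le_add_left _ _) hφ.tendsto_atTop
    refine (hδ.comp hsub).congr fun k => ?_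
    simp only [Function.comp_apply, ← Function.iterate_add_apply]
    rw [show m + φ k + 1 = m + 1 + φ k by ring]
  -- A coordinate that moves by `σ * δ` at time `m` has done so at every earlier time.
  have hcoord (m : ℕ) (i : ι) (σ : ℝ) (hσ : |σ| = 1) :
      σ * (S^[m + 1] y i - S^[m] y i) = δ → σ * (S^[m + 1] y i - y i) = (m + 1) * δ := by
    have hle (u w : ι → ℝ) : σ * (u i - w i) ≤ dist u w :=
      calc σ * (u i - w i) ≤ |σ * (u i - w i)| := le_abs_self _
        _ = dist (u i) (w i) := by rw [abs_mul, hσ, one_mul, Real.dist_eq]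
        _ ≤ dist u w := dist_le_pi_dist u w i
    induction m with
    | zero => intro h; simpa using h
    | succ m ih =>
      intro h
      have h1 := hle (S^[m + 1] y) (S^[m] y)
      have h2 := (hle (N (S^[m + 1] y)) (N (S^[m] y))).trans (hNdist _ _)
      rw [hstep m] at h1 h2
      have hexp : σ * (S^[m + 1 + 1] y i - S^[m + 1] y i) =
          (1 - a) * (σ * (S^[m + 1] y i - S^[m] y i)) +
            a * (σ * (N (S^[m + 1] y) i - N (S^[m] y) i)) := by
        have e (k : ℕ) : S^[k + 1] y i = (1 - a) * S^[k] y i + a * N (S^[k] y) i := by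
          rw [Function.iterate_succ_apply', hS]; rfl
        linear_combination σ * e (m + 1) - σ * e m
      rw [h] at hexp
      have h3 : σ * (S^[m + 1] y i - S^[m] y i) = δ := by
        refine le_antisymm h1 ?_
        nlinarith
      have h4 := ih h3
      push_cast
      linarith
  have hδ₀ : 0 ≤ δ := hstep 0 ▸ dist_nonneg
  have hzero : δ = 0 := by
    by_contra hne
    have hpos : 0 < δ := lt_of_le_of_ne hδ₀ (Ne.symm hne)
    obtain ⟨m, hm⟩ := exists_nat_gt (2 * dist y p / δ)
    rw [div_lt_iff₀ hpos] at hm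
    obtain ⟨i, hi⟩ : ∃ i, δ ≤ dist (S^[m + 1] y i) (S^[m] y i) := by
      by_contra! hlt
      exact ((dist_pi_lt_iff hpos).2 hlt).ne (hstep m)
    have hi' : |S^[m + 1] y i - S^[m] y i| = δ :=
      le_antisymm ((dist_le_pi_dist _ _ i).trans_eq (hstep m)) hi
    obtain ⟨σ, hσ, hσδ⟩ : ∃ σ : ℝ, |σ| = 1 ∧ σ * (S^[m + 1] y i - S^[m] y i) = δ := by
      rcases abs_cases (S^[m + 1] y i - S^[m] y i) with h | h
      · exact ⟨1, by simp, by linarith⟩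
      · exact ⟨-1, by simp, by linarith⟩
    have hfar := hcoord m i σ hσ hσδ
    have hnear : σ * (S^[m + 1] y i - y i) ≤ 2 * dist y p :=
      calc σ * (S^[m + 1] y i - y i) ≤ |σ * (S^[m + 1] y i - y i)| := le_abs_self _
        _ = dist (S^[m + 1] y i) (y i) := by rw [abs_mul, hσ, one_mul, Real.dist_eq]
        _ ≤ dist (S^[m + 1] y) y := dist_le_pi_dist _ _ i
        _ ≤ dist (S^[m + 1] y) p + dist y p := dist_triangle_right _ _ _
        _ ≤ 2 * dist y p := by linarith [hbdd y (m + 1)]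
    nlinarith
  have hSy : S y = y := by
    have := hstep 0
    rw [hzero] at this
    exact dist_eq_zero.1 this
  -- The distance to the fixed point `y` is antitone, so convergence along `φ` is enough.
  refine ⟨y, hfix.1 hSy, tendsto_iff_dist_tendsto_zero.2 ?_⟩
  exact (tendsto_iff_tendsto_subseq_of_antitone (hanti hSy x) hφ.tendsto_atTop).2
    (tendsto_iff_dist_tendsto_zero.1 hy)

/-! ### Subhomogeneous monotone maps and the weighted sup norm -/

variable {n : ℕ} {η : Fin n → ℝ}

theorem weightedSupNorm_nonneg (η x : Fin n → ℝ) : 0 ≤ weightedSupNorm η x := norm_nonneg _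

theorem weightedSupNorm_zero (η : Fin n → ℝ) : weightedSupNorm η 0 = 0 := by
  simp [weightedSupNorm, ← Pi.zero_def]

theorem weightedSupNorm_le_iff (hη : ∀ i, 0 < η i) {x : Fin n → ℝ} {r : ℝ} (hr : 0 ≤ r) :
    weightedSupNorm η x ≤ r ↔ ∀ i, |x i| ≤ r * η i := by
  refine (pi_norm_le_iff_of_nonneg hr).trans (forall_congr' fun i => ?_)
  rw [Real.norm_eq_abs, abs_mul, abs_of_pos (inv_pos.2 (hη i)), inv_mul_le_iff₀ (hη i), mul_comm]

theorem abs_le_weightedSupNorm_mul (hη : ∀ i, 0 < η i) (x : Fin n → ℝ) (i : Fin n) :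
    |x i| ≤ weightedSupNorm η x * η i :=
  (weightedSupNorm_le_iff hη (weightedSupNorm_nonneg η x)).1 le_rfl i

/-- Averaging twice multiplies the step sizes; a small step is an average of a larger one. -/
theorem krasnoselskij_krasnoselskij (T : (Fin n → ℝ) → (Fin n → ℝ)) (a θ : ℝ) (x : Fin n → ℝ) :
    krasnoselskij (krasnoselskij T θ) a x = krasnoselskij T (a * θ) x := by
  simp only [krasnoselskij]
  module

theorem krasnoselskij_eq_self_iff {T : (Fin n → ℝ) → (Fin n → ℝ)} {θ : ℝ} (hθ : θ ≠ 0)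
    {x : Fin n → ℝ} : krasnoselskij T θ x = x ↔ T x = x := by
  have h : krasnoselskij T θ x - x = θ • (T x - x) := by
    simp only [krasnoselskij]
    module
  rw [← sub_eq_zero, h, smul_eq_zero, or_iff_right hθ, sub_eq_zero]

/-- For `θ * (1 + L) ≤ 1`, `T_θ` is a nonnegative combination of the monotone maps `id` and
`T + L • id`. -/
theorem monotone_krasnoselskij {T : (Fin n → ℝ) → (Fin n → ℝ)} {L θ : ℝ}
    (hT : Monotone fun x => T x + L • x) (hθ : 0 ≤ θ) (hθL : θ * (1 + L) ≤ 1) :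
    Monotone (krasnoselskij T θ) := by
  intro x y hxy i
  have h1 := mul_le_mul_of_nonneg_left (hT hxy i) hθ
  have h2 := mul_le_mul_of_nonneg_left (hxy i) (sub_nonneg.2 hθL)
  simp only [krasnoselskij, Pi.add_apply, Pi.smul_apply, smul_eq_mul] at h1 ⊢
  linarith

theorem IsStrictlySubhomogeneous.krasnoselskij {T : (Fin n → ℝ) → (Fin n → ℝ)} {c θ : ℝ}
    (hT : IsStrictlySubhomogeneous c η T) (hθ : 0 ≤ θ) :
    IsStrictlySubhomogeneous (θ * c) η (krasnoselskij T θ) := by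
  intro x t ht i
  have h := mul_le_mul_of_nonneg_left (hT x t ht i) hθ
  simp only [_root_.krasnoselskij, Pi.add_apply, Pi.smul_apply, smul_eq_mul] at h ⊢
  linarith

theorem IsStrictlySubhomogeneous.le_one_add [NeZero n] {T : (Fin n → ℝ) → (Fin n → ℝ)} {c L : ℝ}
    (hη : ∀ i, 0 < η i) (hT : IsStrictlySubhomogeneous c η T)
    (hmono : Monotone fun x => T x + L • x) : c ≤ 1 + L := by
  have hle : (0 : Fin n → ℝ) ≤ 0 + (1 : ℝ) • η := fun i => by simpa using (hη i).le
  have h1 := hT 0 1 one_pos 0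
  have h2 := hmono hle 0
  have h3 := hη 0
  simp only [Pi.add_apply, Pi.smul_apply, Pi.zero_apply, smul_eq_mul] at h1 h2
  nlinarith

/-- A monotone `c`-strictly `η`-subhomogeneous map has Lipschitz constant `1 - c` for the weighted
sup norm: with `r = weightedSupNorm η (x - y)` one has `x ≤ y + r • η`, hence
`S x ≤ S (y + r • η) ≤ S y + (r * (1 - c)) • η`, and symmetrically. -/
theorem IsStrictlySubhomogeneous.weightedSupNorm_sub_le {S : (Fin n → ℝ) → (Fin n → ℝ)} {c : ℝ}
    (hη : ∀ i, 0 < η i) (hS : IsStrictlySubhomogeneous c η S) (hmono : Monotone S)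
    (x y : Fin n → ℝ) :
    weightedSupNorm η (S x - S y) ≤ (1 - c) * weightedSupNorm η (x - y) := by
  rcases eq_or_ne x y with rfl | hne
  · simp [weightedSupNorm_zero]
  set r := weightedSupNorm η (x - y)
  have hxy := abs_le_weightedSupNorm_mul hη (x - y)
  obtain ⟨i₀, hi₀⟩ := Function.ne_iff.1 hne
  have hr : 0 < r := by
    have h := (abs_pos.2 (sub_ne_zero.2 hi₀)).trans_le (hxy i₀)
    exact (pos_iff_pos_of_mul_pos h).2 (hη i₀)
  have hup (u w : Fin n → ℝ) (huw : ∀ i, u i - w i ≤ r * η i) (i : Fin n) :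
      S u i - S w i ≤ (1 - c) * r * η i := by
    have h1 : u ≤ w + r • η := fun j => by
      simpa [add_comm] using sub_le_iff_le_add.1 (huw j)
    have h2 := (hmono h1).trans (hS w r hr) i
    simp only [Pi.add_apply, Pi.smul_apply, smul_eq_mul] at h2
    linarith
  have hx := hup x y fun i => (le_abs_self _).trans (hxy i)
  have hy := hup y x fun i => by
    have := (neg_abs_le _).trans' (neg_le_neg (hxy i))
    simp only [Pi.sub_apply] at this
    linarith
  -- Adding the two bounds at one index shows that the factor `1 - c` is not negative.
  have hc : 0 ≤ (1 - c) * r := by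
    have := add_le_add (hx i₀) (hy i₀)
    nlinarith [hη i₀]
  refine (weightedSupNorm_le_iff hη hc).2 fun i => abs_le.2 ⟨?_, ?_⟩
  · have := hy i
    simp only [Pi.sub_apply]
    linarith
  · exact hx i

/-! ### Iteration in the weighted sup norm -/

/-- The conjugate `[η]⁻¹ ∘ S ∘ [η]` of `S` by the diagonal scaling `[η]` (products and inverses in
`Fin n → ℝ` are componentwise). It turns `weightedSupNorm η` into the plain sup norm. -/
noncomputable def rescale (η : Fin n → ℝ) (S : (Fin n → ℝ) → (Fin n → ℝ)) (y : Fin n → ℝ) :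
    Fin n → ℝ :=
  η⁻¹ * S (η * y)

theorem mul_inv_mul_cancel_of_pos (hη : ∀ i, 0 < η i) (x : Fin n → ℝ) : η * (η⁻¹ * x) = x := by
  ext i
  simp [mul_inv_cancel_left₀ (hη i).ne']

theorem mul_rescale (hη : ∀ i, 0 < η i) (S : (Fin n → ℝ) → (Fin n → ℝ)) (y : Fin n → ℝ) :
    η * rescale η S y = S (η * y) :=
  mul_inv_mul_cancel_of_pos hη _

theorem rescale_eq_self_iff (hη : ∀ i, 0 < η i) {S : (Fin n → ℝ) → (Fin n → ℝ)}
    {y : Fin n → ℝ} : rescale η S y = y ↔ S (η * y) = η * y := by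
  rw [← mul_rescale hη S y]
  have hη' : IsUnit η := Pi.isUnit_iff.2 fun i => (hη i).ne'.isUnit
  exact hη'.mul_right_inj.symm

theorem mul_rescale_iterate (hη : ∀ i, 0 < η i) (S : (Fin n → ℝ) → (Fin n → ℝ))
    (y : Fin n → ℝ) (k : ℕ) : η * (rescale η S)^[k] y = S^[k] (η * y) :=
  Function.Semiconj.iterate_right (f := (η * ·)) (mul_rescale hη S) k y

theorem lipschitzWith_rescale (hη : ∀ i, 0 < η i) {S : (Fin n → ℝ) → (Fin n → ℝ)} {q : NNReal}
    (hS : ∀ x y, weightedSupNorm η (S x - S y) ≤ q * weightedSupNorm η (x - y)) :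
    LipschitzWith q (rescale η S) := by
  have key (x y : Fin n → ℝ) : weightedSupNorm η (x - y) = dist (η⁻¹ * x) (η⁻¹ * y) := by
    rw [dist_eq_norm, ← mul_sub]
    rfl
  refine LipschitzWith.of_dist_le_mul fun x y => ?_
  have h := hS (η * x) (η * y)
  rw [key, key] at h
  have e (x : Fin n → ℝ) : η⁻¹ * (η * x) = x := by
    ext i
    simp [inv_mul_cancel_left₀ (hη i).ne']
  rwa [e, e] at h

theorem tendsto_of_tendsto_rescale (hη : ∀ i, 0 < η i) {S : (Fin n → ℝ) → (Fin n → ℝ)}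
    {x q : Fin n → ℝ} (h : Tendsto (fun k => (rescale η S)^[k] (η⁻¹ * x)) atTop (𝓝 q)) :
    Tendsto (fun k => S^[k] x) atTop (𝓝 (η * q)) := by
  simpa only [mul_rescale_iterate hη, mul_inv_mul_cancel_of_pos hη] using
    (tendsto_const_nhds (x := η)).mul h

/-- Krasnoselskij's theorem for the weighted sup norm. -/
theorem exists_fixedPoint_tendsto_krasnoselskij (hη : ∀ i, 0 < η i)
    {N : (Fin n → ℝ) → (Fin n → ℝ)}
    (hN : ∀ x y, weightedSupNorm η (N x - N y) ≤ weightedSupNorm η (x - y))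
    {p : Fin n → ℝ} (hp : N p = p) {a : ℝ} (ha₀ : 0 < a) (ha₁ : a < 1) (x : Fin n → ℝ) :
    ∃ q, N q = q ∧ Tendsto (trajectory N a x) atTop (𝓝 q) := by
  have hp' : rescale η N (η⁻¹ * p) = η⁻¹ * p := by
    rw [rescale_eq_self_iff hη, mul_inv_mul_cancel_of_pos hη, hp]
  have hS (y : Fin n → ℝ) :
      rescale η (krasnoselskij N a) y = (1 - a) • y + a • rescale η N y := by
    ext i
    simp only [rescale, krasnoselskij, Pi.mul_apply, Pi.inv_apply, Pi.add_apply, Pi.smul_apply,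
      smul_eq_mul]
    field_simp [(hη i).ne']
  obtain ⟨q, hq, hlim⟩ := exists_fixedPoint_tendsto_iterate_averaged
    (lipschitzWith_rescale hη (q := 1) (by simpa using hN)) ha₀ ha₁ hS hp' (η⁻¹ * x)
  exact ⟨η * q, (rescale_eq_self_iff hη).1 hq, tendsto_of_tendsto_rescale hη hlim⟩

/-- Banach's fixed point theorem for the weighted sup norm. -/
theorem exists_fixedPoint_of_weightedSupNorm_contraction (hη : ∀ i, 0 < η i)
    {S : (Fin n → ℝ) → (Fin n → ℝ)} {q : ℝ} (hq₀ : 0 ≤ q) (hq₁ : q < 1)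
    (hS : ∀ x y, weightedSupNorm η (S x - S y) ≤ q * weightedSupNorm η (x - y)) :
    ∃ p, Function.fixedPoints S = {p} ∧ ∀ x, Tendsto (fun k => S^[k] x) atTop (𝓝 p) := by
  have hcontr : ContractingWith ⟨q, hq₀⟩ (rescale η S) :=
    ⟨hq₁, lipschitzWith_rescale hη hS⟩
  refine ⟨η * hcontr.fixedPoint, Set.ext fun x => ⟨fun hx => ?_, fun hx => ?_⟩, fun x =>
    tendsto_of_tendsto_rescale hη (hcontr.tendsto_iterate_fixedPoint _)⟩
  · have hx' : rescale η S (η⁻¹ * x) = η⁻¹ * x := by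
      rw [rescale_eq_self_iff hη, mul_inv_mul_cancel_of_pos hη]
      exact hx
    rw [mem_singleton_iff, ← hcontr.fixedPoint_unique hx', mul_inv_mul_cancel_of_pos hη]
  · rw [mem_singleton_iff.1 hx]
    exact (rescale_eq_self_iff hη).1 hcontr.fixedPoint_isFixedPt

/-! ### The exact convergence rate -/

/-- For a monotone map, the worst contraction factor towards `p` is attained on the line
`p + ℝ • η`, because `p - r • η ≤ x ≤ p + r • η` for `r = weightedSupNorm η (x - p)`. -/
theorem weightedSupNorm_step_le_of_extremal (hη : ∀ i, 0 < η i)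
    {S : (Fin n → ℝ) → (Fin n → ℝ)} (hmono : Monotone S) {p : Fin n → ℝ} {σ : ℝ} (hσ : 0 ≤ σ)
    (h : ∀ r : ℝ, ∀ i, |S (p + r • η) i - p i| ≤ σ * |r| * η i) (x : Fin n → ℝ) :
    weightedSupNorm η (S x - p) ≤ σ * weightedSupNorm η (x - p) := by
  set r := weightedSupNorm η (x - p)
  have hr : 0 ≤ r := weightedSupNorm_nonneg η _
  have hx (i : Fin n) := abs_le.1 (abs_le_weightedSupNorm_mul hη (x - p) i)
  have hup : x ≤ p + r • η := fun i => by
    have := (hx i).2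
    simp only [Pi.sub_apply, Pi.add_apply, Pi.smul_apply, smul_eq_mul] at this ⊢
    linarith
  have hlo : p + (-r) • η ≤ x := fun i => by
    have := (hx i).1
    simp only [Pi.sub_apply, Pi.add_apply, Pi.smul_apply, smul_eq_mul] at this ⊢
    linarith
  refine (weightedSupNorm_le_iff hη (mul_nonneg hσ hr)).2 fun i => abs_le.2 ?_
  have h1 := (abs_le.1 (h r i)).2
  have h2 := (abs_le.1 (h (-r) i)).1
  rw [abs_neg] at h2
  rw [abs_of_nonneg hr] at h1 h2
  have h3 := hmono hup i
  have h4 := hmono hlo i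
  simp only [Pi.sub_apply]
  constructor <;> linarith

/-- If averaging a monotone map `S` with weight `a` gives the contraction factor `ρ` towards `p`,
then `S` itself contracts by the factor `σ` with `ρ = (1 - a) + a * σ`. On the extremal points
`p + r • η` the vectors `S x - p` and `x - p` have the same sign by monotonicity, so no
cancellation occurs in the average. -/
theorem exists_rate_of_krasnoselskij_rate [NeZero n] (hη : ∀ i, 0 < η i)
    {S : (Fin n → ℝ) → (Fin n → ℝ)} (hmono : Monotone S) {p : Fin n → ℝ} (hp : S p = p)
    {a ρ : ℝ} (ha : 0 < a) (hρ₀ : 0 ≤ ρ)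
    (hρ : ∀ x, weightedSupNorm η (krasnoselskij S a x - p) ≤ ρ * weightedSupNorm η (x - p)) :
    ∃ σ, 0 ≤ σ ∧ ρ = (1 - a) + a * σ ∧
      ∀ x, weightedSupNorm η (S x - p) ≤ σ * weightedSupNorm η (x - p) := by
  have hray (r : ℝ) (i : Fin n) :
      |S (p + r • η) i - p i| ≤ (ρ - (1 - a)) / a * |r| * η i := by
    have hnorm : weightedSupNorm η (p + r • η - p) ≤ |r| := by
      refine (weightedSupNorm_le_iff hη (abs_nonneg r)).2 fun i => ?_
      simp [abs_mul, abs_of_pos (hη i)]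
    have h := (weightedSupNorm_le_iff hη (mul_nonneg hρ₀ (abs_nonneg r))).1
      ((hρ (p + r • η)).trans (mul_le_mul_of_nonneg_left hnorm hρ₀)) i
    have hexp : (krasnoselskij S a (p + r • η) - p) i =
        (1 - a) * (r * η i) + a * (S (p + r • η) i - p i) := by
      simp only [krasnoselskij, Pi.sub_apply, Pi.add_apply, Pi.smul_apply, smul_eq_mul]
      ring
    rw [hexp] at h
    rw [div_mul_eq_mul_div, div_mul_eq_mul_div, le_div_iff₀ ha]
    rcases le_total 0 r with hr | hr
    · have hle : p ≤ p + r • η := fun j => by simpa using mul_nonneg hr (hη j).le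
      have hpos := hmono hle i
      rw [hp] at hpos
      rw [abs_of_nonneg (sub_nonneg.2 hpos), abs_of_nonneg hr]
      rw [abs_of_nonneg hr] at h
      linarith [(abs_le.1 h).2]
    · have hle : p + r • η ≤ p := fun j => by
        simpa using mul_nonpos_of_nonpos_of_nonneg hr (hη j).le
      have hneg := hmono hle i
      rw [hp] at hneg
      rw [abs_of_nonpos (sub_nonpos.2 hneg), abs_of_nonpos hr]
      rw [abs_of_nonpos hr] at h
      linarith [(abs_le.1 h).1]
  have hσ : 0 ≤ (ρ - (1 - a)) / a := by
    have h := (abs_nonneg _).trans (hray 1 0)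
    rw [abs_one, mul_one] at h
    exact nonneg_of_mul_nonneg_left h (hη 0)
  exact ⟨_, hσ, by field_simp; ring, weightedSupNorm_step_le_of_extremal hη hmono hσ hray⟩

/-- As every state is the initial state of a trajectory, one step suffices to test the rate. -/
theorem convergenceRate_eq (η : Fin n → ℝ) (T : (Fin n → ℝ) → (Fin n → ℝ)) (p : Fin n → ℝ)
    (θ : ℝ) : convergenceRate η T p θ = sInf {ρ : ℝ | 0 ≤ ρ ∧ ∀ x,
      weightedSupNorm η (krasnoselskij T θ x - p) ≤ ρ * weightedSupNorm η (x - p)} := by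
  unfold convergenceRate trajectory
  congr 1
  ext ρ
  refine and_congr_right fun _ => ⟨fun h x => h x 0, fun h x k => ?_⟩
  rw [Function.iterate_succ_apply']
  exact h _

theorem convergenceRate_le {T : (Fin n → ℝ) → (Fin n → ℝ)} {p : Fin n → ℝ} {θ ρ : ℝ}
    (hρ₀ : 0 ≤ ρ)
    (hρ : ∀ x, weightedSupNorm η (krasnoselskij T θ x - p) ≤ ρ * weightedSupNorm η (x - p)) :
    convergenceRate η T p θ ≤ ρ := by
  rw [convergenceRate_eq]
  exact csInf_le ⟨0, fun _ h => h.1⟩ ⟨hρ₀, hρ⟩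

/-- Shrinking a step `θ` for which `T_θ` is monotone by the factor `a` makes the rate at least the
average of `1` and the rate at `θ`. The hypothesis on `ρ` ensures that the infimum defining the rate at `a * θ` is over a
nonempty set. -/
theorem averaged_le_convergenceRate [NeZero n] (hη : ∀ i, 0 < η i)
    {T : (Fin n → ℝ) → (Fin n → ℝ)} {p : Fin n → ℝ} {a θ ρ : ℝ} (hp : T p = p) (hθ : θ ≠ 0)
    (hmono : Monotone (krasnoselskij T θ)) (ha : 0 < a) (hρ₀ : 0 ≤ ρ)
    (hρ : ∀ x, weightedSupNorm η (krasnoselskij T (a * θ) x - p) ≤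
      ρ * weightedSupNorm η (x - p)) :
    (1 - a) + a * convergenceRate η T p θ ≤ convergenceRate η T p (a * θ) := by
  rw [convergenceRate_eq η T p (a * θ)]
  refine le_csInf ⟨ρ, hρ₀, hρ⟩ fun τ hτ => ?_
  obtain ⟨σ, hσ₀, rfl, hσ⟩ := exists_rate_of_krasnoselskij_rate hη hmono
    ((krasnoselskij_eq_self_iff hθ).2 hp) ha hτ.1
    (by simpa only [krasnoselskij_krasnoselskij] using hτ.2)
  gcongr
  exact convergenceRate_le hσ₀ hσ

/-! ### Convergence of the Krasnoselskij iteration -/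

theorem corollary3p1 (n : ℕ) (hn : 1 ≤ n) (T : (Fin n → ℝ) → (Fin n → ℝ))
    (hLip : ∃ K, LipschitzWith K T)
    (hMetzler : ∀ᵐ x ∂(volume : Measure (Fin n → ℝ)), IsMetzler (jacobian T x))
    (L : ℝ) (hL : L = diagL (fun x => -T x)) :
    -- the subhomogeneous case; `1 / (1 + L)` is read as `+∞` when `1 + L = 0`
    (∀ η : Fin n → ℝ, (∀ i, 0 < η i) → IsSubhomogeneous η T →
      (Function.fixedPoints T).Nonempty →
        0 ≤ 1 + L ∧
        ∀ θ : ℝ, 0 < θ → (1 + L ≠ 0 → θ < 1 / (1 + L)) →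
          ∀ x₀ : Fin n → ℝ, ∃ p ∈ Function.fixedPoints T,
            Tendsto (trajectory T θ x₀) atTop (𝓝 p)) ∧
    -- the strictly subhomogeneous case
    (∀ η : Fin n → ℝ, (∀ i, 0 < η i) → ∀ c : ℝ, 0 < c → IsStrictlySubhomogeneous c η T →
        0 < 1 + L ∧
        ∃ p : Fin n → ℝ, Function.fixedPoints T = {p} ∧
          (∀ θ ∈ Ioc 0 (1 / (1 + L)), ∀ x₀ : Fin n → ℝ,
            Tendsto (trajectory T θ x₀) atTop (𝓝 p) ∧
            ∀ k : ℕ, weightedSupNorm η (trajectory T θ x₀ (k + 1) - p)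
              ≤ (1 - θ * c) * weightedSupNorm η (trajectory T θ x₀ k - p)) ∧
          -- both the guaranteed factor and the actual rate are smallest at `θ = 1 / (1 + L)`
          (∀ θ ∈ Ioo 0 (1 / (1 + L)),
            1 - 1 / (1 + L) * c < 1 - θ * c ∧
            convergenceRate η T p (1 / (1 + L)) < convergenceRate η T p θ)) := by
  have : NeZero n := ⟨by lia⟩
  obtain ⟨K, hK⟩ := hLip
  have hmono : Monotone fun x => T x + L • x := hL ▸ monotone_add_diagL_smul hK hMetzler
  have hmonoθ {θ : ℝ} (hθ : 0 ≤ θ) (h : θ * (1 + L) ≤ 1) : Monotone (krasnoselskij T θ) :=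
    monotone_krasnoselskij hmono hθ h
  refine ⟨fun η hη hsub ⟨p, hp⟩ => ?_, fun η hη c hc hsub => ?_⟩
  · have hL₀ : 0 ≤ 1 + L := hsub.le_one_add hη hmono
    refine ⟨hL₀, fun θ hθ hθL x₀ => ?_⟩
    -- A larger admissible step `s`, so that `T_θ` is a proper average of `T_s`.
    obtain ⟨s, hθs, hs⟩ : ∃ s, θ < s ∧ s * (1 + L) ≤ 1 := by
      rcases eq_or_ne (1 + L) 0 with h | h
      · exact ⟨θ + 1, by linarith, by simp [h]⟩
      · exact ⟨1 / (1 + L), hθL h, (one_div_mul_cancel h).le⟩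
    have hs₀ : 0 < s := hθ.trans hθs
    have hnonexp := (hsub.krasnoselskij hs₀.le).weightedSupNorm_sub_le hη (hmonoθ hs₀.le hs)
    obtain ⟨q, hq, hlim⟩ := exists_fixedPoint_tendsto_krasnoselskij hη
      (by simpa using hnonexp) ((krasnoselskij_eq_self_iff hs₀.ne').2 hp)
      (div_pos hθ hs₀) ((div_lt_one hs₀).2 hθs) x₀
    refine ⟨q, (krasnoselskij_eq_self_iff hs₀.ne').1 hq, ?_⟩
    have hθ' : krasnoselskij (krasnoselskij T s) (θ / s) = krasnoselskij T θ := by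
      ext1 x
      rw [krasnoselskij_krasnoselskij, div_mul_cancel₀ _ hs₀.ne']
    have htraj : trajectory (krasnoselskij T s) (θ / s) x₀ = trajectory T θ x₀ := by
      ext1 k
      simp only [trajectory, hθ']
    rwa [← htraj]
  · have hcL : c ≤ 1 + L := hsub.le_one_add hη hmono
    have hL₀ : 0 < 1 + L := hc.trans_le hcL
    have hmem {θ : ℝ} (hθ : θ ∈ Ioc 0 (1 / (1 + L))) : θ * (1 + L) ≤ 1 :=
      (le_div_iff₀ hL₀).1 hθ.2
    have hfac {θ : ℝ} (hθ : θ ∈ Ioc 0 (1 / (1 + L))) : 0 ≤ 1 - θ * c := by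
      nlinarith [hmem hθ, hθ.1]
    have hcontr {θ : ℝ} (hθ : θ ∈ Ioc 0 (1 / (1 + L))) (x y : Fin n → ℝ) :
        weightedSupNorm η (krasnoselskij T θ x - krasnoselskij T θ y) ≤
          (1 - θ * c) * weightedSupNorm η (x - y) :=
      (hsub.krasnoselskij hθ.1.le).weightedSupNorm_sub_le hη (hmonoθ hθ.1.le (hmem hθ)) x y
    have hbanach {θ : ℝ} (hθ : θ ∈ Ioc 0 (1 / (1 + L))) :
        ∃ p, Function.fixedPoints T = {p} ∧ ∀ x, Tendsto (trajectory T θ x) atTop (𝓝 p) := by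
      obtain ⟨p, hp, hlim⟩ := exists_fixedPoint_of_weightedSupNorm_contraction hη (hfac hθ)
        (by nlinarith [mul_pos hθ.1 hc]) (hcontr hθ)
      refine ⟨p, ?_, hlim⟩
      rw [← hp]
      ext x
      exact (krasnoselskij_eq_self_iff hθ.1.ne').symm
    set s := 1 / (1 + L)
    have hs : s ∈ Ioc 0 s := ⟨one_div_pos.2 hL₀, le_rfl⟩
    obtain ⟨p, hp, -⟩ := hbanach hs
    have hTp : T p = p := by
      have : p ∈ Function.fixedPoints T := hp ▸ mem_singleton p
      exact this
    have hrate {θ : ℝ} (hθ : θ ∈ Ioc 0 s) (x : Fin n → ℝ) :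
        weightedSupNorm η (krasnoselskij T θ x - p) ≤ (1 - θ * c) * weightedSupNorm η (x - p) := by
      simpa only [(krasnoselskij_eq_self_iff hθ.1.ne').2 hTp] using hcontr hθ x p
    refine ⟨hL₀, p, hp, fun θ hθ x₀ => ⟨?_, fun k => ?_⟩, fun θ hθ => ⟨?_, ?_⟩⟩
    · obtain ⟨q, hq, hlim⟩ := hbanach hθ
      obtain rfl : p = q := singleton_eq_singleton_iff.1 (hp.symm.trans hq)
      exact hlim x₀
    · rw [trajectory, Function.iterate_succ_apply']
      exact hrate hθ _
    · nlinarith [hθ.2]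
    · have hs₀ : 0 < s := hs.1
      have hθ' : θ ∈ Ioc 0 s := ⟨hθ.1, hθ.2.le⟩
      have ha₁ : θ / s < 1 := (div_lt_one hs₀).2 hθ.2
      have haθ : θ / s * s = θ := div_mul_cancel₀ _ hs₀.ne'
      have hlt : convergenceRate η T p s < 1 :=
        (convergenceRate_le (hfac hs) (hrate hs)).trans_lt (by nlinarith)
      have hge := averaged_le_convergenceRate hη hTp hs₀.ne' (hmonoθ hs₀.le (hmem hs))
        (div_pos hθ.1 hs₀) (hfac hθ') (by simpa only [haθ] using hrate hθ')
      rw [haθ] at hge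
      nlinarith
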